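/- **Definitions.** Let $f:\mathbb R^n\to\mathbb R$ be Lipschitz. Its generalized gradient is $\partial f(x)=\{g:\langle g,d\rangle\le f^\circ(x;d)\ \forall d\}$, where $f^\circ(x;d)=\limsup_{y\to x,\,t\downarrow 0}\frac{f(y+td)-f(y)}{t}$. A point $x$ is $(\delta,\epsilon)$-stationary if $d\bigl(0,\mathrm{conv}\bigcup_{\|y-x\|\le\delta}\partial f(y)\bigr)\le\epsilon$. The function $f$ has the Hadamard directional derivative $f'(x;d)$ if $\frac1t(f(\varphi(t))-f(x))\to f'(x;d)$ as $t\to0^+$ for every curve $\varphi$ with $\varphi(0)=x$ and $\frac1t(\varphi(t)-x)\to d$. For $\Delta,L>0$ and an initial point $x_1$, let $\mathcal F(\Delta,L)$ be the set of all $L$-Lipschitz $f:\mathbb R^n\to\mathbb R$ that have Hadamard directional derivatives at all points in all directions and satisfy $f(x_1)-\inf f\le\Delta$. A deterministic oracle for $f$ is a (measurable) map $\mathbb O(x,d)=(f(x),g_x)$ with $g_x\in\partial f(x)$ and $\langle g_x,d\rangle=f'(x;d)$. **Algorithm (Interpolated Normalized Gradient Descent, parameters $K,T\in\mathbb N$).**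 Start at $x_1$. For $t=1,\dots,T$ repeat the following pass. Call the oracle at $(x_t,0)$ and let $m_{t,1}$ be the returned gradient. For $k=1,\dots,K$, put $x_{t,k}=x_t-\delta\, m_{t,k}/\|m_{t,k}\|$ and: * if $\|m_{t,k}\|\le\epsilon$, terminate and return $x_t$; * else, if $f(x_{t,k})-f(x_t)<-\delta\|m_{t,k}\|/4$, set $x_{t+1}=x_{t,k}$ and go on to $t+1$; * else sample $y_{t,k+1}$ uniformly (and independently of the past) from the segment $[x_t,x_{t,k}]$, call the oracle at $(y_{t,k+1},-m_{t,k})$, let $g_{t,k+1}$ be the returned gradient, and set $m_{t,k+1}=\beta_{t,k}m_{t,k}+(1-\beta_{t,k})g_{t,k+1}$ with $\beta_{t,k}=\frac{4L^2-\|m_{t,k}\|^2}{4L^2+2\|m_{t,k}\|^2}$. If the loop over $k$ ends without a return or a move to $t+1$, start another pass at the same $x_t$. The oracle calls counted are the two kinds of calls named above. **Theorem.** Let $\Delta,L,\delta,\epsilon>0$, $0<\gamma<1$, $f\in\mathcal F(\Delta,L)$, and let $\mathbb O$ be a deterministic oracle for $f$. Run the algorithm with $K=\lceil 48L^2/\epsilon^2\rceil$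 and $T=\lceil 4\Delta/(\epsilon\delta)\rceil$. Then, with probability at least $1-\gamma$, it returns a $(\delta,\epsilon)$-stationary point of $f$ using at most $$T\,K\,\max\Bigl\{1,\log\frac{T}{\gamma}\Bigr\}\quad\text{oracle calls.}$$ In particular, if $48L^2/\epsilon^2$ and $4\Delta/(\epsilon\delta)$ are integers (so that $K=48L^2/\epsilon^2$ and $T=4\Delta/(\epsilon\delta)$) and $\log\frac{4\Delta}{\gamma\delta\epsilon}\ge1$, then with probability at least $1-\gamma$ it returns a $(\delta,\epsilon)$-stationary point using at most $$\frac{192\,\Delta L^2}{\epsilon^3\delta}\,\log\Bigl(\frac{4\Delta}{\gamma\delta\epsilon}\Bigr)\quad\text{oracle calls.}$$ -/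

import Mathlib

open Filter Topology MeasureTheory ProbabilityTheory

noncomputable section

namespace INGD

section Nonsmooth

variable {E : Type*} [NormedAddCommGroup E] [InnerProductSpace ℝ E]

/-- Clarke's generalized directional derivative
`f°(x; d) = limsup_{y → x, t ↓ 0} (f (y + t d) - f y) / t`. -/
def clarkeDirDeriv (f : E → ℝ) (x d : E) : ℝ :=
  limsup (fun p : E × ℝ => (f (p.1 + p.2 • d) - f p.1) / p.2) (𝓝 x ×ˢ 𝓝[>] (0 : ℝ))

/-- The generalized gradient `∂f(x) = {g | ⟪g, d⟫ ≤ f°(x; d) for all d}`. -/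
def clarkeGradient (f : E → ℝ) (x : E) : Set E :=
  {g | ∀ d : E, inner ℝ g d ≤ clarkeDirDeriv f x d}

/-- The Goldstein subdifferential `∂f(x + δB) = conv (⋃_{y ∈ x + δB} ∂f(y))`. -/
def goldstein (f : E → ℝ) (δ : ℝ) (x : E) : Set E :=
  convexHull ℝ (⋃ y ∈ Metric.closedBall x δ, clarkeGradient f y)

/-- `x` is `(δ, ε)`-stationary: `d(0, ∂f(x + δB)) ≤ ε`. The extended distance is used, so that
an empty set is at distance `∞`. -/
def IsGoldsteinStationary (f : E → ℝ) (δ ε : ℝ) (x : E) : Prop :=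
  Metric.infEDist (0 : E) (goldstein f δ x) ≤ ENNReal.ofReal ε

/-- `c` is the directional derivative `f'(x; d)` in the sense of Hadamard: it is the derivative of
`f` at `0⁺` along every curve `φ` that leaves `x` with velocity `d`. -/
def HasHadamardDirDeriv (f : E → ℝ) (x d : E) (c : ℝ) : Prop :=
  ∀ φ : ℝ → E, φ 0 = x →
    Tendsto (fun t : ℝ => t⁻¹ • (φ t - φ 0)) (𝓝[>] 0) (𝓝 d) →
    Tendsto (fun t : ℝ => t⁻¹ * (f (φ t) - f x)) (𝓝[>] 0) (𝓝 c)

/-- `f` is directionally differentiable in the sense of Hadamard at all points. -/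
def HadamardDirDifferentiable (f : E → ℝ) : Prop :=
  ∀ x d : E, ∃ c : ℝ, HasHadamardDirDeriv f x d c

/-- The class `𝓕(Δ, L)` with reference point `x₀`. -/
structure FunctionClass (Δ L : ℝ) (x₀ : E) (f : E → ℝ) : Prop where
  lipschitz : ∀ x y : E, |f x - f y| ≤ L * ‖x - y‖
  dirDiff : HadamardDirDifferentiable f
  bddBelow : BddBelow (Set.range f)
  gap : f x₀ - ⨅ x, f x ≤ Δ

/-- A deterministic oracle for `f`: `O x d = (f x, g)` where `g ∈ ∂f(x)` and
`⟪g, d⟫ = f'(x; d)`. -/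
structure IsOracle (f : E → ℝ) (O : E → E → ℝ × E) : Prop where
  value : ∀ x d : E, (O x d).1 = f x
  grad_mem : ∀ x d : E, (O x d).2 ∈ clarkeGradient f x
  grad_dir : ∀ x d : E, HasHadamardDirDeriv f x d (inner ℝ (O x d).2 d)

end Nonsmooth

section Algorithm

/-- A configuration of Interpolated Normalized Gradient Descent. -/
structure State (E : Type*) where
  /-- outer counter `t` -/
  t : ℕ
  /-- inner counter `k`; the value `0` means that a pass through the while loop is about to start
  (so that `m` is not yet meaningful) -/
  k : ℕ
  /-- the iterate `x_t` -/
  x : E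
  /-- the direction `m_{t,k}` -/
  m : E
  /-- number of executed oracle calls -/
  calls : ℕ
  /-- the returned point, if the algorithm has returned one -/
  out : Option E

variable {E : Type*} [NormedAddCommGroup E] [InnerProductSpace ℝ E]

/-- The trial point `x - δ m / ‖m‖`. -/
def trial (δ : ℝ) (x m : E) : E := x - (δ / ‖m‖) • m

/-- The weight `β = (4L² - ‖m‖²) / (4L² + 2‖m‖²)`. -/
def weight (L : ℝ) (m : E) : ℝ := (4 * L ^ 2 - ‖m‖ ^ 2) / (4 * L ^ 2 + 2 * ‖m‖ ^ 2)

/-- One step of the algorithm; `u ∈ [0, 1]` is the random number from which the interpolation point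
is computed if this step samples one. The cases are, in order:
* the algorithm has already stopped (it has returned a point, or `t` has run through `1, …, T`);
* a pass of the while loop starts: call the oracle at `x_t` in direction `0`, set `k = 1`;
* the for loop has run through `k = 1, …, K`. Then `‖m_{t,K}‖ > ε`, since otherwise the algorithm
  would have returned at `k = K`; hence the while loop starts its next pass;
* `‖m_{t,k}‖ ≤ ε`: return `x_t`;
* the descent condition holds: leave the while loop, move to `x_{t+1} = x_{t,k}`;
* otherwise call the oracle at the random point `y = x_t + u (x_{t,k} - x_t)` in direction
  `-m_{t,k}`, and average. -/
def step (f : E → ℝ) (O : E → E → ℝ × E) (L δ ε : ℝ) (K T : ℕ) (u : ℝ) (s : State E) : State E :=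
  if s.out.isSome ∨ T < s.t then s
  else if s.k = 0 then
    { s with k := 1, m := (O s.x 0).2, calls := s.calls + 1 }
  else if K < s.k then
    { s with k := 0 }
  else if ‖s.m‖ ≤ ε then
    { s with out := some s.x }
  else if f (trial δ s.x s.m) - f s.x < -(δ * ‖s.m‖ / 4) then
    { s with t := s.t + 1, k := 0, x := trial δ s.x s.m }
  else
    { s with
      k := s.k + 1
      m := weight L s.m • s.m +
        (1 - weight L s.m) • (O (s.x + u • (trial δ s.x s.m - s.x)) (-s.m)).2
      calls := s.calls + 1 }

/-- The configuration after `j` steps, started from `x₁`, with random numbers `u 0, u 1, …`. -/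
def run (f : E → ℝ) (O : E → E → ℝ × E) (L δ ε : ℝ) (K T : ℕ) (x₁ : E) (u : ℕ → ℝ) :
    ℕ → State E
  | 0 => { t := 1, k := 0, x := x₁, m := 0, calls := 0, out := none }
  | j + 1 => step f O L δ ε K T (u j) (run f O L δ ε K T x₁ u j)

/-- The algorithm returns a `(δ, ε)`-stationary point of `f` after at most `B` oracle calls. -/
def FindsWithin (f : E → ℝ) (O : E → E → ℝ × E) (L δ ε : ℝ) (K T : ℕ) (x₁ : E) (u : ℕ → ℝ)
    (B : ℝ) : Prop :=
  ∃ (j : ℕ) (x : E), (run f O L δ ε K T x₁ u j).out = some x ∧ IsGoldsteinStationary f δ ε x ∧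
    ((run f O L δ ε K T x₁ u j).calls : ℝ) ≤ B

end Algorithm

end INGD

end

/-!
The algorithm runs through at most `T` values of `t`: each move from `t` to `t + 1` lowers `f` by
more than `δ ε / 4`, and `T` such moves would bring `f` below its infimum. A point that is returned
is stationary, since every direction `m` is a convex combination of generalized gradients at points
of the ball of radius `δ` (`Invariant`). What remains is to bound the number of passes of the while
loop that run through all `K` values of `k` without a return or a move.

Write `a = ‖m‖²`. Without sufficient descent, the mean slope of `f` along the segment to the trial
point is at least `-‖m‖ / 4`. The oracle gives right derivatives along this segment, which integrate
to the increment of `f` (`integral_inner_oracle`), so a gradient `g` at a uniform random point of it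
satisfies `𝔼 ⟪m, g⟫ ≤ a / 4`. With the chosen weight this makes the mean of the next squared norm at
most `a / (1 + c a)`, where `c = 3 / (8 L²)` (`weight_sq_mul_add_le`). The function
`a ↦ a / (1 + j c a)` is concave, and replacing `a` by `a / (1 + c a)` turns it into
`a ↦ a / (1 + (j + 1) c a)`. Jensen's inequality, in the form of a tangent line bound, and Markov's
inequality show that a pass is unsuccessful with probability at most
`8 L² / (ε² (3 K + 5)) ≤ 1 / 18 ≤ exp (-5/2)` (`passBound_one_le`).

The budget of calls for each `t` is `K ℓ` with `ℓ = max 1 (log (T / γ))`. An unsuccessful pass costs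
`K + 1` calls, and for `ℓ` below `2` only one whole pass fits. A failure probability of `1 / 3` for
each pass, which exceeds `exp (-ℓ)` for `ℓ` near `2`, would not be enough for a count of whole
passes. With failure probability `exp (-5/2)`, the number `R = ⌈2 ℓ / 5⌉` of passes fits into the
budget, and the union bound over `t` gives `T exp (-5 R / 2) ≤ T exp (-ℓ) ≤ γ` (`exists_passes`).

The bounds are combined in one function on configurations, `potential`, which is a supermartingale
along the run (`lintegral_potential_countedStep_le`, `lintegral_orbit_le`), starts at
`T exp (-5 R / 2)`, and equals `1` once some while loop has had `R` unsuccessful passes.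
-/

noncomputable section

namespace INGD

/-! ### Generalized gradients and oracle answers along segments -/

section Gradients

variable {E : Type*} [NormedAddCommGroup E] [InnerProductSpace ℝ E]

omit [InnerProductSpace ℝ E] in
theorem continuous_of_abs_sub_le {f : E → ℝ} {L : ℝ} (hL : 0 ≤ L)
    (hf : ∀ x y, |f x - f y| ≤ L * ‖x - y‖) : Continuous f := by
  have : LipschitzWith L.toNNReal f := LipschitzWith.of_dist_le_mul fun y z => by
    rw [Real.dist_eq, dist_eq_norm, Real.coe_toNNReal _ hL]
    exact hf y z
  exact this.continuous

theorem clarkeDirDeriv_le {f : E → ℝ} {L : ℝ} (hf : ∀ x y, |f x - f y| ≤ L * ‖x - y‖)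
    (x d : E) : clarkeDirDeriv f x d ≤ L * ‖d‖ := by
  have key : ∀ᶠ p in 𝓝 x ×ˢ 𝓝[>] (0 : ℝ), |(f (p.1 + p.2 • d) - f p.1) / p.2| ≤ L * ‖d‖ := by
    have h0 : ∀ᶠ p in 𝓝 x ×ˢ 𝓝[>] (0 : ℝ), 0 < p.2 :=
      tendsto_snd.eventually (self_mem_nhdsWithin)
    filter_upwards [h0] with p hp
    have h := hf (p.1 + p.2 • d) p.1
    rw [add_sub_cancel_left, norm_smul, Real.norm_of_nonneg hp.le] at h
    rw [abs_div, abs_of_pos hp, div_le_iff₀ hp]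
    linarith
  refine limsup_le_of_le ?_ (key.mono fun p hp => (abs_le.1 hp).2)
  refine IsCoboundedUnder.of_frequently_ge (a := -(L * ‖d‖)) ?_
  exact (key.mono fun p hp => (abs_le.1 hp).1).frequently

theorem norm_le_of_mem_clarkeGradient {f : E → ℝ} {L : ℝ} (hL : 0 ≤ L)
    (hf : ∀ x y, |f x - f y| ≤ L * ‖x - y‖) {x g : E} (hg : g ∈ clarkeGradient f x) :
    ‖g‖ ≤ L := by
  have h := (hg g).trans (clarkeDirDeriv_le hf x g)
  rw [real_inner_self_eq_norm_sq] at h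
  rcases (norm_nonneg g).eq_or_lt with h0 | h0
  · rw [← h0]; exact hL
  · nlinarith

theorem norm_le_of_mem_goldstein {f : E → ℝ} {L δ : ℝ} (hL : 0 ≤ L)
    (hf : ∀ x y, |f x - f y| ≤ L * ‖x - y‖) {x g : E} (hg : g ∈ goldstein f δ x) : ‖g‖ ≤ L := by
  have hsub : goldstein f δ x ⊆ Metric.closedBall 0 L := by
    refine convexHull_min ?_ (convex_closedBall 0 L)
    refine Set.iUnion₂_subset fun y _ v hv => ?_
    simpa using norm_le_of_mem_clarkeGradient hL hf hv
  simpa using hsub hg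

theorem clarkeGradient_subset_goldstein {f : E → ℝ} {δ : ℝ} {x y : E} (h : ‖y - x‖ ≤ δ) :
    clarkeGradient f y ⊆ goldstein f δ x :=
  (Set.subset_biUnion_of_mem (u := fun y => clarkeGradient f y)
    (mem_closedBall_iff_norm.2 h)).trans (subset_convexHull ℝ _)

theorem isGoldsteinStationary_of_norm_le {f : E → ℝ} {δ ε : ℝ} {x m : E}
    (hm : m ∈ goldstein f δ x) (h : ‖m‖ ≤ ε) : IsGoldsteinStationary f δ ε x := by
  refine (Metric.infEDist_le_edist_of_mem hm).trans ?_
  rw [edist_dist, dist_zero_left]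
  exact ENNReal.ofReal_le_ofReal h

theorem norm_trial_sub {δ : ℝ} (hδ : 0 ≤ δ) {x m : E} (hm : m ≠ 0) : ‖trial δ x m - x‖ = δ := by
  have := norm_pos_iff.2 hm
  rw [trial, sub_sub_cancel_left, norm_neg, norm_smul, norm_div, norm_norm,
    Real.norm_of_nonneg hδ]
  field_simp

omit [InnerProductSpace ℝ E] in
theorem weight_nonneg {L : ℝ} {m : E} (h : ‖m‖ ≤ L) : 0 ≤ weight L m := by
  unfold weight
  have := norm_nonneg m
  apply div_nonneg <;> nlinarith

omit [InnerProductSpace ℝ E] in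
theorem weight_le_one (L : ℝ) (m : E) : weight L m ≤ 1 := by
  unfold weight
  exact div_le_one_of_le₀ (by nlinarith [sq_nonneg ‖m‖]) (by positivity)

/-- The averaged direction stays in the Goldstein subdifferential: the interpolation point lies in
the ball of radius `δ`, and the new direction is a convex combination. -/
theorem average_mem_goldstein {f : E → ℝ} {O : E → E → ℝ × E} (hO : IsOracle f O) {L δ u : ℝ}
    (hδ : 0 ≤ δ) {x m : E} (hm : m ∈ goldstein f δ x) (hm0 : m ≠ 0) (hmL : ‖m‖ ≤ L)
    (hu : u ∈ Set.Icc (0 : ℝ) 1) :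
    weight L m • m + (1 - weight L m) • (O (x + u • (trial δ x m - x)) (-m)).2
      ∈ goldstein f δ x := by
  refine (convex_convexHull ℝ _) hm ?_ (weight_nonneg hmL)
    (sub_nonneg.2 (weight_le_one L m)) (by ring)
  refine clarkeGradient_subset_goldstein ?_ (hO.grad_mem _ _)
  rw [add_sub_cancel_left, norm_smul, norm_trial_sub hδ hm0, Real.norm_of_nonneg hu.1]
  nlinarith [hu.2]

/-- Along a line, Hadamard's derivative is the right derivative: test it on the line itself. -/
theorem HasHadamardDirDeriv.hasDerivWithinAt {f : E → ℝ} {x d : E} {τ c : ℝ}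
    (h : HasHadamardDirDeriv f (x + τ • d) d c) :
    HasDerivWithinAt (fun s : ℝ => f (x + s • d)) c (Set.Ioi τ) τ := by
  have h1 := h (fun s => x + τ • d + s • d) (by simp) (by
    refine tendsto_const_nhds.congr' ?_
    filter_upwards [self_mem_nhdsWithin] with s (hs : 0 < s)
    simp [smul_smul, inv_mul_cancel₀ hs.ne'])
  rw [hasDerivWithinAt_iff_tendsto_slope' (by simp)]
  have h2 : Tendsto (fun s : ℝ => s - τ) (𝓝[>] τ) (𝓝[>] 0) := by
    refine tendsto_nhdsWithin_iff.2 ⟨?_, ?_⟩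
    · have : Tendsto (fun s : ℝ => s - τ) (𝓝 τ) (𝓝 (τ - τ)) :=
        (continuous_id.sub continuous_const).tendsto τ
      rw [sub_self] at this
      exact this.mono_left nhdsWithin_le_nhds
    · filter_upwards [self_mem_nhdsWithin] with s hs
      simpa using hs
  refine (h1.comp h2).congr fun s => ?_
  simp only [Function.comp, slope, vsub_eq_sub, smul_eq_mul]
  rw [add_assoc, ← add_smul, add_sub_cancel]

variable [MeasurableSpace E] [BorelSpace E] [SecondCountableTopology E]

/-- The oracle answers along a segment, in the direction of the segment, are right derivatives, so
they integrate to the increment of `f`. The rescaling by `a` puts the segment on `[0, 1]`. -/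
theorem integral_inner_oracle {f : E → ℝ} {O : E → E → ℝ × E} (hO : IsOracle f O)
    (hOm : Measurable (Function.uncurry O)) {L : ℝ} (hL : 0 ≤ L)
    (hf : ∀ x y, |f x - f y| ≤ L * ‖x - y‖) (x d : E) (a : ℝ) :
    Integrable (fun u : ℝ => inner ℝ (O (x + u • a • d) d).2 d)
        (volume.restrict (Set.Icc (0 : ℝ) 1)) ∧
      a * ∫ u in Set.Icc (0 : ℝ) 1, inner ℝ (O (x + u • a • d) d).2 d = f (x + a • d) - f x := by
  have hcont := continuous_of_abs_sub_le hL hf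
  have hmeas : Measurable fun s : ℝ => inner ℝ (O (x + s • d) d).2 d := by
    have h1 : Measurable fun s : ℝ => O (x + s • d) d :=
      hOm.comp (((measurable_id.smul_const d).const_add x).prodMk measurable_const)
    exact h1.snd.inner measurable_const
  have hbd : ∀ y : E, ‖(inner ℝ (O y d).2 d : ℝ)‖ ≤ L * ‖d‖ := fun y =>
    (norm_inner_le_norm _ _).trans <| mul_le_mul_of_nonneg_right
      (norm_le_of_mem_clarkeGradient hL hf (hO.grad_mem _ _)) (norm_nonneg _)
  have hii : ∀ p q : ℝ, IntervalIntegrable (fun s : ℝ => inner ℝ (O (x + s • d) d).2 d)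
      volume p q := fun p q => by
    refine (intervalIntegrable_const (c := L * ‖d‖)).mono_fun hmeas.aestronglyMeasurable ?_
    exact Eventually.of_forall fun s => (hbd _).trans (le_abs_self _)
  have hmeas' : Measurable fun u : ℝ => inner ℝ (O (x + u • a • d) d).2 d := by
    have := hmeas.comp (measurable_id.mul_const a)
    simpa only [Function.comp_def, id, mul_smul] using this
  have hint : Integrable (fun u : ℝ => inner ℝ (O (x + u • a • d) d).2 d)
      (volume.restrict (Set.Icc (0 : ℝ) 1)) :=
    Integrable.of_bound hmeas'.aestronglyMeasurable (L * ‖d‖) (Eventually.of_forall fun u => hbd _)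
  refine ⟨hint, ?_⟩
  have hftc := intervalIntegral.integral_eq_sub_of_hasDeriv_right (a := 0) (b := a)
    (f := fun s : ℝ => f (x + s • d)) (by fun_prop)
    (fun s _ => (hO.grad_dir (x + s • d) d).hasDerivWithinAt) (hii 0 a)
  rw [integral_Icc_eq_integral_Ioc, ← intervalIntegral.integral_of_le zero_le_one]
  have hsub := intervalIntegral.mul_integral_comp_mul_right
    (f := fun s : ℝ => (inner ℝ (O (x + s • d) d).2 d : ℝ)) (a := 0) (b := 1) a
  simp only [mul_smul, zero_mul, one_mul] at hsub
  rw [hsub, hftc]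
  simp

end Gradients

/-! ### Decrease of the direction within a pass -/

section PassBound

/-- Bound for the probability that a pass of the while loop which has reached the inner counter `k`
with `‖m‖² = a` runs through to `k = K + 1`. -/
def passBound (L ε : ℝ) (K k : ℕ) (a : ℝ) : ℝ :=
  a / (ε ^ 2 * (1 + ((K : ℝ) - k) * (3 / (8 * L ^ 2)) * a))

theorem passBound_nonneg {L ε : ℝ} {K k : ℕ} (hk : k ≤ K) {a : ℝ} (ha : 0 ≤ a) :
    0 ≤ passBound L ε K k a := by
  have : (0 : ℝ) ≤ (K : ℝ) - k := sub_nonneg.2 (by exact_mod_cast hk)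
  unfold passBound
  positivity

theorem one_le_passBound_self {L ε : ℝ} (hε : 0 < ε) (K : ℕ) {a : ℝ} (ha : ε ^ 2 ≤ a) :
    1 ≤ passBound L ε K K a := by
  unfold passBound
  rw [sub_self, zero_mul, zero_mul, add_zero, mul_one, one_le_div (by positivity)]
  exact ha

/-- A complete pass, started from a gradient of norm at most `L`, fails with probability at most
`1/18`. -/
theorem passBound_one_le {L ε : ℝ} (hL : 0 < L) (hε : 0 < ε) {K : ℕ} (hK1 : 1 ≤ K)
    (hK : 48 * L ^ 2 / ε ^ 2 ≤ K) {a : ℝ} (ha : 0 ≤ a) (haL : a ≤ L ^ 2) :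
    passBound L ε K 1 a ≤ 1 / 18 := by
  have hK1' : (0 : ℝ) ≤ (K : ℝ) - 1 := sub_nonneg.2 (by exact_mod_cast hK1)
  rw [div_le_iff₀ (by positivity)] at hK
  unfold passBound
  rw [div_le_div_iff₀ (by push_cast; positivity) (by norm_num)]
  have e : ((K : ℝ) - (1 : ℕ)) * (3 / (8 * L ^ 2)) * a
      = ((K : ℝ) - 1) * (3 / 8) * (a / L ^ 2) := by push_cast; field_simp
  rw [e]
  obtain ⟨r, hr⟩ : ∃ r, r = a / L ^ 2 := ⟨_, rfl⟩
  have har : a = r * L ^ 2 := by rw [hr]; field_simp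
  have hr0 : 0 ≤ r := by rw [hr]; positivity
  have hr1 : r ≤ 1 := by rw [hr]; exact div_le_one_of_le₀ haL (by positivity)
  rw [← hr, har]
  have hε2 : 0 ≤ ε ^ 2 := by positivity
  nlinarith [mul_le_mul_of_nonneg_left hK hr0, mul_nonneg hε2 (sub_nonneg.2 hr1),
    mul_nonneg hε2 hr0]

/-- Tangent line bound for the concave function `passBound L ε K k`, at the point that the
recursion `a ↦ a / (1 + 3 a / (8 L²))` produces. There its value is the bound one counter earlier,
with argument `a`. -/
theorem passBound_succ_le {L ε : ℝ} (hL : 0 < L) (hε : 0 < ε) {K k : ℕ} (hk : k < K) {a : ℝ}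
    (ha : 0 ≤ a) : ∃ D : ℝ, 0 ≤ D ∧ ∀ z, 0 ≤ z → passBound L ε K (k + 1) z ≤
      passBound L ε K k a + D * (z - a / (1 + 3 / (8 * L ^ 2) * a)) := by
  obtain ⟨J, hJ⟩ : ∃ J : ℝ, J = (K : ℝ) - (k + 1 : ℕ) := ⟨_, rfl⟩
  have hJ0 : 0 ≤ J := by rw [hJ]; exact sub_nonneg.2 (by exact_mod_cast hk)
  obtain ⟨c, hc⟩ : ∃ c : ℝ, c = 3 / (8 * L ^ 2) := ⟨_, rfl⟩
  have hc0 : 0 ≤ c := by rw [hc]; positivity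
  have hJ' : (K : ℝ) - k = J + 1 := by rw [hJ]; push_cast; ring
  obtain ⟨b, hb⟩ : ∃ b : ℝ, b = a / (1 + c * a) := ⟨_, rfl⟩
  have hb0 : 0 ≤ b := by rw [hb]; positivity
  have hval : passBound L ε K k a = b / (ε ^ 2 * (1 + J * c * b)) := by
    unfold passBound
    rw [hJ', ← hc, hb]
    have h1 : 0 < 1 + c * a := by positivity
    have h2 : 0 < 1 + (J + 1) * c * a := by positivity
    have h3 : 1 + J * c * (a / (1 + c * a)) = (1 + (J + 1) * c * a) / (1 + c * a) := by
      field_simp; ring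
    rw [h3]
    field_simp
  refine ⟨1 / (ε ^ 2 * (1 + J * c * b) ^ 2), by positivity, fun z hz => ?_⟩
  rw [hval, ← hc, ← hb]
  unfold passBound
  rw [← hJ, ← hc]
  have hz1 : 0 < 1 + J * c * z := by positivity
  have hb1 : 0 < 1 + J * c * b := by positivity
  have : b / (ε ^ 2 * (1 + J * c * b)) + 1 / (ε ^ 2 * (1 + J * c * b) ^ 2) * (z - b)
      - z / (ε ^ 2 * (1 + J * c * z))
      = J * c * (z - b) ^ 2 / (ε ^ 2 * (1 + J * c * b) ^ 2 * (1 + J * c * z)) := by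
    field_simp
    ring
  have h0 : 0 ≤ J * c * (z - b) ^ 2 / (ε ^ 2 * (1 + J * c * b) ^ 2 * (1 + J * c * z)) := by
    positivity
  linarith

variable {E : Type*} [NormedAddCommGroup E] [InnerProductSpace ℝ E]

omit [InnerProductSpace ℝ E] in
/-- The weight is the minimizer of this quadratic bound for the mean of the new squared norm. -/
theorem weight_sq_mul_add_le {L : ℝ} (hL : 0 < L) (m : E) :
    weight L m ^ 2 * ‖m‖ ^ 2 + 2 * weight L m * (1 - weight L m) * (‖m‖ ^ 2 / 4) +
      (1 - weight L m) ^ 2 * L ^ 2 ≤ ‖m‖ ^ 2 / (1 + 3 / (8 * L ^ 2) * ‖m‖ ^ 2) := by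
  obtain ⟨a, ha⟩ : ∃ a, a = ‖m‖ ^ 2 := ⟨_, rfl⟩
  have ha0 : 0 ≤ a := by rw [ha]; positivity
  unfold weight
  rw [← ha]
  have h1 : ((4 * L ^ 2 - a) / (4 * L ^ 2 + 2 * a)) ^ 2 * a +
      2 * ((4 * L ^ 2 - a) / (4 * L ^ 2 + 2 * a)) *
        (1 - (4 * L ^ 2 - a) / (4 * L ^ 2 + 2 * a)) * (a / 4) +
      (1 - (4 * L ^ 2 - a) / (4 * L ^ 2 + 2 * a)) ^ 2 * L ^ 2 =
      a * (16 * L ^ 2 - a) / (16 * L ^ 2 + 8 * a) := by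
    field_simp
    ring
  have h2 : a / (1 + 3 / (8 * L ^ 2) * a) = a * (8 * L ^ 2) / (8 * L ^ 2 + 3 * a) := by
    field_simp
  rw [h1, h2, div_le_div_iff₀ (by positivity) (by positivity)]
  have : 0 ≤ a * (3 * a ^ 2 + 24 * a * L ^ 2) := by positivity
  nlinarith

variable [MeasurableSpace E] [BorelSpace E] [SecondCountableTopology E]

/-- When the trial point does not give sufficient descent, averaging with a gradient at a uniform
random point of the segment advances the pass bound by one counter in the mean. -/
theorem lintegral_passBound_average_le {f : E → ℝ} {O : E → E → ℝ × E} (hO : IsOracle f O)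
    (hOm : Measurable (Function.uncurry O)) {L δ ε : ℝ} (hL : 0 < L) (hδ : 0 < δ) (hε : 0 < ε)
    (hf : ∀ x y, |f x - f y| ≤ L * ‖x - y‖) {x m : E} (hm0 : m ≠ 0) (hmL : ‖m‖ ≤ L)
    (hdesc : ¬ f (trial δ x m) - f x < -(δ * ‖m‖ / 4)) {K k : ℕ} (hk : k < K)
    {A B : ℝ} (hA : 0 ≤ A) (hB : 0 ≤ B) :
    ∫⁻ u in Set.Icc (0 : ℝ) 1, ENNReal.ofReal (A + B * passBound L ε K (k + 1)
      (‖weight L m • m + (1 - weight L m) • (O (x + u • (trial δ x m - x)) (-m)).2‖ ^ 2))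
      ≤ ENNReal.ofReal (A + B * passBound L ε K k (‖m‖ ^ 2)) := by
  obtain ⟨w, hw⟩ : ∃ w, w = weight L m := ⟨_, rfl⟩
  have hw0 : 0 ≤ w := hw ▸ weight_nonneg hmL
  have hw1 : w ≤ 1 := hw ▸ weight_le_one L m
  have hquad := weight_sq_mul_add_le hL m
  rw [← hw] at hquad ⊢
  obtain ⟨D, hD, htan⟩ := passBound_succ_le (ε := ε) hL hε hk (sq_nonneg ‖m‖)
  have hmpos : 0 < ‖m‖ := norm_pos_iff.2 hm0
  have htr : trial δ x m - x = (δ / ‖m‖) • (-m) := by simp [trial]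
  have htr' : x + (δ / ‖m‖) • (-m) = trial δ x m := by simp [trial, sub_eq_add_neg]
  obtain ⟨hint, hval⟩ := integral_inner_oracle hO hOm hL.le hf x (-m) (δ / ‖m‖)
  rw [htr'] at hval
  rw [htr]
  set G : ℝ → ℝ := fun u => inner ℝ (O (x + u • (δ / ‖m‖) • (-m)) (-m)).2 (-m) with hG
  have hGint : -(‖m‖ ^ 2 / 4) ≤ ∫ u in Set.Icc (0 : ℝ) 1, G u := by
    have h1 : -(δ * ‖m‖ / 4) ≤ δ / ‖m‖ * ∫ u in Set.Icc (0 : ℝ) 1, G u := by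
      rw [hval]; exact not_lt.1 hdesc
    have h2 := mul_le_mul_of_nonneg_left h1 (div_pos hmpos hδ).le
    rw [← mul_assoc, div_mul_div_cancel₀ hδ.ne', div_self hmpos.ne', one_mul] at h2
    refine le_of_eq_of_le ?_ h2
    field_simp
  set b := ‖m‖ ^ 2 / (1 + 3 / (8 * L ^ 2) * ‖m‖ ^ 2) with hb
  set H : ℝ → ℝ := fun u => (A + B * (passBound L ε K k (‖m‖ ^ 2) +
    D * (w ^ 2 * ‖m‖ ^ 2 + (1 - w) ^ 2 * L ^ 2 - b))) + (-(B * D * (2 * w * (1 - w)))) * G u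
    with hH
  have hpt : ∀ u, A + B * passBound L ε K (k + 1)
      (‖w • m + (1 - w) • (O (x + u • (δ / ‖m‖) • (-m)) (-m)).2‖ ^ 2) ≤ H u := by
    intro u
    have hg := norm_le_of_mem_clarkeGradient hL.le hf
      (hO.grad_mem (x + u • (δ / ‖m‖) • (-m)) (-m))
    obtain ⟨g, hgdef⟩ : ∃ g, g = (O (x + u • (δ / ‖m‖) • (-m)) (-m)).2 := ⟨_, rfl⟩
    have hGu : G u = -inner ℝ m g := by
      simp only [hG, ← hgdef, inner_neg_right, real_inner_comm]
    rw [← hgdef] at hg ⊢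
    have hz : ‖w • m + (1 - w) • g‖ ^ 2 ≤
        w ^ 2 * ‖m‖ ^ 2 - 2 * w * (1 - w) * G u + (1 - w) ^ 2 * L ^ 2 := by
      rw [norm_add_sq_real, norm_smul, norm_smul, real_inner_smul_left, real_inner_smul_right,
        Real.norm_of_nonneg hw0, Real.norm_of_nonneg (sub_nonneg.2 hw1), hGu]
      have : ‖g‖ ^ 2 ≤ L ^ 2 := pow_le_pow_left₀ (norm_nonneg _) hg 2
      nlinarith [mul_le_mul_of_nonneg_left this (sq_nonneg (1 - w))]
    have h1 := htan _ (sq_nonneg ‖w • m + (1 - w) • g‖)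
    have h2 := mul_le_mul_of_nonneg_left hz hD
    have h3 : passBound L ε K (k + 1) (‖w • m + (1 - w) • g‖ ^ 2) ≤
        passBound L ε K k (‖m‖ ^ 2) +
        D * (w ^ 2 * ‖m‖ ^ 2 - 2 * w * (1 - w) * G u + (1 - w) ^ 2 * L ^ 2 - b) := by
      rw [hb]; linarith
    have h4 := mul_le_mul_of_nonneg_left h3 hB
    rw [hH]
    linarith
  have hH0 : ∀ u, 0 ≤ H u := fun u => le_trans
    (add_nonneg hA (mul_nonneg hB (passBound_nonneg hk (sq_nonneg _)))) (hpt u)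
  have hHint : Integrable H (volume.restrict (Set.Icc (0 : ℝ) 1)) :=
    (integrable_const _).add (hint.const_mul _)
  refine (lintegral_mono fun u => ENNReal.ofReal_le_ofReal (hpt u)).trans ?_
  rw [← ofReal_integral_eq_lintegral_ofReal hHint (Eventually.of_forall hH0)]
  refine ENNReal.ofReal_le_ofReal ?_
  rw [hH, integral_add (integrable_const _) (hint.const_mul _), integral_const_mul]
  simp only [integral_const, MeasurableSet.univ, measureReal_restrict_apply, Set.univ_inter,
    Real.volume_real_Icc, smul_eq_mul]
  have h5 : 0 ≤ B * D * (2 * w * (1 - w)) := by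
    have := sub_nonneg.2 hw1
    positivity
  have h6 := mul_le_mul_of_nonneg_left hGint h5
  have h7 := mul_le_mul_of_nonneg_left hquad (mul_nonneg hB hD)
  norm_num
  linarith

end PassBound

/-! ### Supermartingales along random iterations -/

section RandomIteration

variable {S : Type*}

/-- The orbit of `s₀` under the maps `g (u 0), g (u 1), …`. -/
def orbit (g : ℝ → S → S) (s₀ : S) (u : ℕ → ℝ) : ℕ → S
  | 0 => s₀
  | j + 1 => g (u j) (orbit g s₀ u j)

theorem orbit_congr (g : ℝ → S → S) (s₀ : S) {u v : ℕ → ℝ} {j : ℕ} (h : ∀ i < j, u i = v i) :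
    orbit g s₀ u j = orbit g s₀ v j := by
  induction j with
  | zero => rfl
  | succ j ih =>
    rw [orbit, orbit, ih fun i hi => h i (hi.trans j.lt_succ_self), h j j.lt_succ_self]

variable [MeasurableSpace S]

theorem measurable_orbit {g : ℝ → S → S} (hg : Measurable (Function.uncurry g)) (s₀ : S) (j : ℕ) :
    Measurable fun u : ℕ → ℝ => orbit g s₀ u j := by
  induction j with
  | zero => exact measurable_const
  | succ j ih => exact hg.comp ((measurable_pi_apply j).prodMk ih)

variable {Ω : Type*} [MeasurableSpace Ω] {μ : Measure Ω} [IsProbabilityMeasure μ]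

omit [IsProbabilityMeasure μ] in
/-- The point `orbit g s₀ U j` depends on `U 0, …, U (j - 1)` only. -/
theorem indepFun_orbit {U : ℕ → Ω → ℝ} (hUm : ∀ j, Measurable (U j)) (hUind : iIndepFun U μ)
    {g : ℝ → S → S} (hg : Measurable (Function.uncurry g)) (s₀ : S) (j : ℕ) :
    IndepFun (U j) (fun ω => orbit g s₀ (fun i => U i ω) j) μ := by
  have h := hUind.indepFun_finset {j} (Finset.range j) (by simp) hUm
  have hext : Measurable fun (v : Finset.range j → ℝ) (i : ℕ) =>
      if hi : i ∈ Finset.range j then v ⟨i, hi⟩ else 0 := by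
    refine measurable_pi_lambda _ fun i => ?_
    by_cases hi : i ∈ Finset.range j
    · simpa only [dif_pos hi] using measurable_pi_apply _
    · simp only [dif_neg hi, measurable_const]
  have h2 := h.comp (measurable_pi_apply ⟨j, Finset.mem_singleton_self j⟩)
    ((measurable_orbit hg s₀ j).comp hext)
  refine h2.congr (Eventually.of_forall fun ω => rfl) (Eventually.of_forall fun ω => ?_)
  refine orbit_congr g s₀ fun i hi => ?_
  simp [hi]

omit [IsProbabilityMeasure μ] in
theorem map_eq_restrict_of_isUniform {X : Ω → ℝ}
    (hX : pdf.IsUniform X (Set.Icc (0 : ℝ) 1) μ volume) :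
    μ.map X = volume.restrict (Set.Icc (0 : ℝ) 1) := by
  rw [hX, ProbabilityTheory.cond]
  simp

omit [IsProbabilityMeasure μ] in
theorem ae_mem_Icc_of_isUniform {U : ℕ → Ω → ℝ} (hUm : ∀ j, Measurable (U j))
    (hU : ∀ j, pdf.IsUniform (U j) (Set.Icc (0 : ℝ) 1) μ volume) :
    ∀ᵐ ω ∂μ, ∀ j, U j ω ∈ Set.Icc (0 : ℝ) 1 := by
  refine ae_all_iff.2 fun j => ?_
  refine ae_of_ae_map (hUm j).aemeasurable ?_
  rw [map_eq_restrict_of_isUniform (hU j)]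
  exact ae_restrict_mem measurableSet_Icc

/-- A function whose mean does not increase in a step with a fresh uniform number is a
supermartingale along the random orbit. The one-step inequality is needed only at points that the
orbit can reach. -/
theorem lintegral_orbit_le {U : ℕ → Ω → ℝ} (hUm : ∀ j, Measurable (U j)) (hUind : iIndepFun U μ)
    (hU : ∀ j, pdf.IsUniform (U j) (Set.Icc (0 : ℝ) 1) μ volume)
    {g : ℝ → S → S} (hg : Measurable (Function.uncurry g)) (s₀ : S) {V : S → ENNReal}
    (hV : Measurable V)
    (hstep : ∀ (u : ℕ → ℝ) (j : ℕ), (∀ i, u i ∈ Set.Icc (0 : ℝ) 1) →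
      ∫⁻ v in Set.Icc (0 : ℝ) 1, V (g v (orbit g s₀ u j)) ≤ V (orbit g s₀ u j)) (j : ℕ) :
    ∫⁻ ω, V (orbit g s₀ (fun i => U i ω) j) ∂μ ≤ V s₀ := by
  induction j with
  | zero => simp [orbit]
  | succ j ih =>
    refine le_trans ?_ ih
    have hUall : Measurable fun ω (i : ℕ) => U i ω := measurable_pi_lambda _ hUm
    have hX : Measurable fun ω => orbit g s₀ (fun i => U i ω) j :=
      (measurable_orbit hg s₀ j).comp hUall
    have hpair := (indepFun_iff_map_prod_eq_prod_map_map (hUm j).aemeasurable hX.aemeasurable).1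
      (indepFun_orbit hUm hUind hg s₀ j)
    have hVg : Measurable fun z : ℝ × S => V (g z.1 z.2) := hV.comp hg
    calc ∫⁻ ω, V (orbit g s₀ (fun i => U i ω) (j + 1)) ∂μ
        = ∫⁻ z, V (g z.1 z.2) ∂(μ.map fun ω => (U j ω, orbit g s₀ (fun i => U i ω) j)) := by
          rw [lintegral_map hVg ((hUm j).prodMk hX)]
          rfl
      _ = ∫⁻ s, (∫⁻ v in Set.Icc (0 : ℝ) 1, V (g v s))
            ∂(μ.map fun ω => orbit g s₀ (fun i => U i ω) j) := by
          rw [hpair, lintegral_prod_symm _ hVg.aemeasurable, map_eq_restrict_of_isUniform (hU j)]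
      _ ≤ ∫⁻ s, V s ∂(μ.map fun ω => orbit g s₀ (fun i => U i ω) j) := by
          refine lintegral_mono_ae ?_
          rw [ae_map_iff hX.aemeasurable (measurableSet_le hVg.lintegral_prod_left' hV)]
          filter_upwards [ae_mem_Icc_of_isUniform hUm hU] with ω hω
          exact hstep _ j hω
      _ = ∫⁻ ω, V (orbit g s₀ (fun i => U i ω) j) ∂μ := lintegral_map hV hX

end RandomIteration

/-! ### The run with a count of unsuccessful passes -/

section CountedRun

variable {E : Type*} [NormedAddCommGroup E] [InnerProductSpace ℝ E]

/-- One step of the algorithm, together with a count of the passes of the current while loop that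
ran through all `K` values of the inner counter. The count returns to `0` when the while loop is
left, unless it has reached `R`; from then on it is frozen, so that it records that some while
loop had `R` unsuccessful passes. -/
def countedStep (f : E → ℝ) (O : E → E → ℝ × E) (L δ ε : ℝ) (K T R : ℕ) (u : ℝ)
    (p : State E × ℕ) : State E × ℕ :=
  (step f O L δ ε K T u p.1,
    if R ≤ p.2 ∨ p.1.out.isSome ∨ T < p.1.t ∨ p.1.k = 0 then p.2
    else if K < p.1.k then p.2 + 1
    else if ‖p.1.m‖ ≤ ε then p.2
    else if f (trial δ p.1.x p.1.m) - f p.1.x < -(δ * ‖p.1.m‖ / 4) then 0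
    else p.2)

/-- The initial configuration, with no unsuccessful passes. -/
def start (x₁ : E) : State E × ℕ :=
  ({ t := 1, k := 0, x := x₁, m := 0, calls := 0, out := none }, 0)

theorem orbit_countedStep_fst (f : E → ℝ) (O : E → E → ℝ × E) (L δ ε : ℝ) (K T R : ℕ) (x₁ : E)
    (u : ℕ → ℝ) (j : ℕ) :
    (orbit (countedStep f O L δ ε K T R) (start x₁) u j).1 =
      run f O L δ ε K T x₁ u j := by
  induction j with
  | zero => rfl
  | succ j ih => rw [orbit, run, ← ih]; rfl

/-- What holds of the configuration and the count of unsuccessful passes after `j` steps. A while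
loop with fewer than `R` unsuccessful passes costs at most `(R - 1) (K + 1) + K` calls and
`R (K + 2)` steps; the subtraction `t - 1` counts the while loops that have been left. -/
structure Invariant (f : E → ℝ) (δ ε : ℝ) (K T R : ℕ) (x₁ : E) (j : ℕ) (p : State E × ℕ) :
    Prop where
  t_pos : 1 ≤ p.1.t
  t_le : p.1.t ≤ T
  k_le : p.1.k ≤ K + 1
  value : f p.1.x ≤ f x₁ - ((p.1.t : ℝ) - 1) * (δ * ε / 4)
  grad : p.1.k ≠ 0 → p.1.m ∈ goldstein f δ p.1.x
  calls_le : p.1.out = none → p.2 < R →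
    p.1.calls ≤ (p.1.t - 1) * ((R - 1) * (K + 1) + K) + p.2 * (K + 1) + p.1.k
  time_le : p.1.out = none → p.2 < R →
    j ≤ ((p.1.t - 1) * R + p.2) * (K + 2) + p.1.k
  returned : ∀ y, p.1.out = some y → IsGoldsteinStationary f δ ε y ∧
    (p.2 < R → p.1.calls ≤ T * ((R - 1) * (K + 1) + K))

theorem Invariant.step {f : E → ℝ} {O : E → E → ℝ × E} (hO : IsOracle f O) {Δ L δ ε : ℝ}
    (hL : 0 < L) (hδ : 0 < δ) (hε : 0 < ε) {x₁ : E} (hf : FunctionClass Δ L x₁ f) {K T R j : ℕ}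
    (hT : 4 * Δ / (ε * δ) ≤ T) {u : ℝ} (hu : u ∈ Set.Icc (0 : ℝ) 1) {p : State E × ℕ}
    (hp : Invariant f δ ε K T R x₁ j p) :
    Invariant f δ ε K T R x₁ (j + 1) (countedStep f O L δ ε K T R u p) := by
  obtain ⟨⟨t, k, x, m, calls, out⟩, F⟩ := p
  obtain ⟨t_pos, t_le, k_le, value, grad, calls_le, time_le, returned⟩ := hp
  dsimp only at t_pos t_le k_le value grad calls_le time_le returned
  rcases out with _ | y
  swap
  · simp only [countedStep, INGD.step, Option.isSome_some, true_or, or_true, if_true]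
    exact ⟨t_pos, t_le, k_le, value, grad, by simp, by simp, returned⟩
  have hnT : ¬ T < t := not_lt.2 t_le
  replace calls_le := calls_le rfl
  replace time_le := time_le rfl
  obtain ⟨s, rfl⟩ := Nat.exists_eq_add_of_le' t_pos
  simp only [Nat.add_sub_cancel] at calls_le time_le
  by_cases hk0 : k = 0
  · subst hk0
    simp only [countedStep, INGD.step, Option.isSome_none, hnT, Bool.false_eq_true, or_self,
      or_true, if_true, if_false]
    refine ⟨t_pos, t_le, by simp, value, fun _ => ?_, fun _ h => ?_, fun _ h => ?_, by simp⟩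
    · exact clarkeGradient_subset_goldstein (by simpa using hδ.le) (hO.grad_mem _ _)
    · have := calls_le h
      dsimp only
      simp only [Nat.add_sub_cancel]
      omega
    · have := time_le h
      dsimp only
      simp only [Nat.add_sub_cancel]
      omega
  have hgrad := grad hk0
  have hmL := norm_le_of_mem_goldstein hL.le hf.lipschitz hgrad
  by_cases hkK : K < k
  · obtain rfl : k = K + 1 := by omega
    simp only [countedStep, INGD.step, Option.isSome_none, hnT, Bool.false_eq_true, or_self,
      or_false, if_false, hk0, hkK, if_true]
    refine ⟨t_pos, t_le, by simp, value, by simp, fun _ h => ?_, fun _ h => ?_, by simp⟩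
    · dsimp only at h ⊢
      simp only [Nat.add_sub_cancel]
      split_ifs at h ⊢ with hR
      · omega
      · have := calls_le (not_le.1 hR)
        nlinarith
    · dsimp only at h ⊢
      simp only [Nat.add_sub_cancel]
      split_ifs at h ⊢ with hR
      · omega
      · have := time_le (not_le.1 hR)
        nlinarith
  have hfull : F < R → F * (K + 1) + k ≤ (R - 1) * (K + 1) + K := fun h => by
    have := Nat.mul_le_mul_right (K + 1) (Nat.le_sub_one_of_lt h)
    omega
  by_cases hme : ‖m‖ ≤ ε
  · simp only [countedStep, INGD.step, Option.isSome_none, hnT, Bool.false_eq_true, or_self,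
      or_false, if_false, hk0, hkK, hme, if_true, ite_self]
    refine ⟨t_pos, t_le, k_le, value, grad, by simp, by simp, ?_⟩
    intro y hy
    obtain rfl : x = y := by simpa using hy
    refine ⟨isGoldsteinStationary_of_norm_le hgrad hme, fun h => ?_⟩
    have h1 := calls_le h
    have h2 := Nat.mul_le_mul_right ((R - 1) * (K + 1) + K) t_le
    have h3 := hfull h
    dsimp only
    nlinarith
  have hm0 : m ≠ 0 := by
    rintro rfl
    exact hme (by simpa using hε.le)
  by_cases hd : f (trial δ x m) - f x < -(δ * ‖m‖ / 4)
  · simp only [countedStep, INGD.step, Option.isSome_none, hnT, Bool.false_eq_true, or_self,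
      or_false, if_false, hk0, hkK, hme, hd, if_true]
    have hval : f (trial δ x m) < f x₁ - ((s : ℝ) + 1) * (δ * ε / 4) := by
      have := mul_lt_mul_of_pos_left (not_le.1 hme) hδ
      push_cast at value
      linarith
    -- A descent step at `t = T` would bring `f` below its infimum.
    have hsT : s + 1 < T := by
      refine lt_of_le_of_ne t_le fun h => ?_
      have h1 : f x₁ - Δ ≤ f (trial δ x m) := by
        linarith [hf.gap, ciInf_le hf.bddBelow (trial δ x m)]
      rw [div_le_iff₀ (by positivity)] at hT
      rw [← h] at hT
      push_cast at hT
      linarith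
    refine ⟨by simp, hsT, by simp, ?_, by simp, fun _ h => ?_, fun _ h => ?_, by simp⟩
    · push_cast
      linarith
    · dsimp only at h ⊢
      simp only [Nat.add_sub_cancel]
      split_ifs at h ⊢ with hR
      · omega
      · have h1 := calls_le (not_le.1 hR)
        have h3 := hfull (not_le.1 hR)
        nlinarith
    · dsimp only at h ⊢
      simp only [Nat.add_sub_cancel]
      split_ifs at h ⊢ with hR
      · omega
      · have h1 := time_le (not_le.1 hR)
        have h2 : (F + 1) * (K + 2) ≤ R * (K + 2) := Nat.mul_le_mul_right _ (not_le.1 hR)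
        have h3 : k ≤ K := not_lt.1 hkK
        nlinarith
  · simp only [countedStep, INGD.step, Option.isSome_none, hnT, Bool.false_eq_true, or_self,
      or_false, if_false, hk0, hkK, hme, hd, ite_self]
    refine ⟨t_pos, t_le, ?_, value, fun _ => ?_, fun _ h => ?_, fun _ h => ?_, by simp⟩
    · dsimp only
      omega
    · exact average_mem_goldstein hO hδ.le hgrad hm0 hmL hu
    · have := calls_le h
      dsimp only
      simp only [Nat.add_sub_cancel]
      omega
    · have := time_le h
      dsimp only
      simp only [Nat.add_sub_cancel]
      omega

theorem invariant_orbit {f : E → ℝ} {O : E → E → ℝ × E} (hO : IsOracle f O) {Δ L δ ε : ℝ}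
    (hL : 0 < L) (hδ : 0 < δ) (hε : 0 < ε) {x₁ : E} (hf : FunctionClass Δ L x₁ f) {K T R : ℕ}
    (hT : 4 * Δ / (ε * δ) ≤ T) (hT1 : 1 ≤ T) {u : ℕ → ℝ} (hu : ∀ i, u i ∈ Set.Icc (0 : ℝ) 1)
    (j : ℕ) :
    Invariant f δ ε K T R x₁ j
      (orbit (countedStep f O L δ ε K T R) (start x₁) u j) := by
  induction j with
  | zero => exact ⟨le_rfl, hT1, by simp [orbit, start], by simp [orbit, start],
      by simp [orbit, start], by simp [orbit, start], by simp, by simp [orbit, start]⟩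
  | succ j ih => exact ih.step hO hL hδ hε hf hT (hu j)

/-- After `T R (K + 2)` steps the algorithm has stopped, unless some while loop had `R` unsuccessful
passes. -/
theorem Invariant.out_ne_none {f : E → ℝ} {δ ε : ℝ} {K T R j : ℕ} {x₁ : E} {p : State E × ℕ}
    (hp : Invariant f δ ε K T R x₁ j p) (hF : p.2 < R) (hj : T * R * (K + 2) ≤ j) :
    p.1.out ≠ none := by
  intro h
  have h1 := hp.time_le h hF
  have h2 := hp.k_le
  have h3 : (p.1.t - 1) * R + p.2 + 1 ≤ T * R := by
    have := Nat.mul_le_mul_right R hp.t_le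
    obtain ⟨s, hs⟩ := Nat.exists_eq_add_of_le' hp.t_pos
    rw [hs] at this ⊢
    rw [Nat.add_sub_cancel]
    linarith
  have := Nat.mul_le_mul_right (K + 2) h3
  linarith

/-- Bound for the conditional probability that some while loop has `R` unsuccessful passes: a
union bound over the values of `t` still to come, plus the bound for the current while loop. The
number `q` bounds the probability that a whole pass is unsuccessful. -/
def potential (L ε q : ℝ) (K T R : ℕ) (p : State E × ℕ) : ℝ :=
  if R ≤ p.2 then 1
  else if p.1.out.isSome then 0
  else ((T : ℝ) - p.1.t) * q ^ R + q ^ (R - 1 - p.2) *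
    (if p.1.k = 0 then q else if K < p.1.k then 1 else passBound L ε K p.1.k (‖p.1.m‖ ^ 2))

variable [MeasurableSpace E] [BorelSpace E] [SecondCountableTopology E]

/-- The potential is a supermartingale. Only the averaging step is random; every other step does not
increase the potential. -/
theorem lintegral_potential_countedStep_le {f : E → ℝ} {O : E → E → ℝ × E} (hO : IsOracle f O)
    (hOm : Measurable (Function.uncurry O)) {Δ L δ ε q : ℝ}
    (hL : 0 < L) (hδ : 0 < δ) (hε : 0 < ε) {x₁ : E} (hf : FunctionClass Δ L x₁ f) {K T R j : ℕ}
    (hK : 48 * L ^ 2 / ε ^ 2 ≤ K) (hK1 : 1 ≤ K) (hq : 1 / 18 ≤ q)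
    {p : State E × ℕ} (hp : Invariant f δ ε K T R x₁ j p) :
    ∫⁻ u in Set.Icc (0 : ℝ) 1, ENNReal.ofReal (potential L ε q K T R
      (countedStep f O L δ ε K T R u p)) ≤ ENNReal.ofReal (potential L ε q K T R p) := by
  have hq0 : 0 ≤ q := by linarith
  have hdet : (∀ u, potential L ε q K T R (countedStep f O L δ ε K T R u p) ≤
      potential L ε q K T R p) → ∫⁻ u in Set.Icc (0 : ℝ) 1, ENNReal.ofReal (potential L ε q K T R
      (countedStep f O L δ ε K T R u p)) ≤ ENNReal.ofReal (potential L ε q K T R p) := fun h => by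
    refine (lintegral_mono fun u => ENNReal.ofReal_le_ofReal (h u)).trans ?_
    simp
  obtain ⟨⟨t, k, x, m, calls, out⟩, F⟩ := p
  obtain ⟨t_pos, t_le, k_le, -, grad, -, -, -⟩ := hp
  dsimp only at t_pos t_le k_le grad
  by_cases hR : R ≤ F
  · refine hdet fun u => ?_
    simp [potential, countedStep, hR]
  rcases out with _ | y
  swap
  · refine hdet fun u => ?_
    simp [potential, countedStep, step, hR]
  have hnT : ¬ T < t := not_lt.2 t_le
  have htT : (0 : ℝ) ≤ ((T : ℝ) - t) * q ^ R :=
    mul_nonneg (sub_nonneg.2 (by exact_mod_cast t_le)) (by positivity)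
  by_cases hk0 : k = 0
  · subst hk0
    refine hdet fun u => ?_
    have hg := norm_le_of_mem_clarkeGradient hL.le hf.lipschitz (hO.grad_mem x 0)
    have h1 := passBound_one_le hL hε hK1 hK (sq_nonneg ‖(O x 0).2‖)
      (pow_le_pow_left₀ (norm_nonneg _) hg 2)
    simp only [potential, countedStep, step, Option.isSome_none, hnT, hR, Bool.false_eq_true,
      or_self, or_true, if_true, if_false, one_ne_zero, not_lt.2 hK1]
    gcongr
    exact h1.trans hq
  have hgrad := grad hk0
  have hmL := norm_le_of_mem_goldstein hL.le hf.lipschitz hgrad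
  by_cases hkK : K < k
  · refine hdet fun u => ?_
    simp only [potential, countedStep, step, Option.isSome_none, hnT, hR, Bool.false_eq_true,
      or_self, if_true, if_false, hk0, hkK]
    by_cases hF : R ≤ F + 1
    · have : R - 1 - F = 0 := by omega
      simpa [hF, this] using htT
    · have : R - 1 - F = R - 1 - (F + 1) + 1 := by omega
      simp only [hF, if_false, this, pow_succ, mul_one, le_refl]
  by_cases hme : ‖m‖ ≤ ε
  · refine hdet fun u => ?_
    simp only [potential, countedStep, step, Option.isSome_none, hnT, hR, Bool.false_eq_true,
      or_self, if_true, if_false, hk0, hkK, hme, Option.isSome_some]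
    have := passBound_nonneg (L := L) (ε := ε) (not_lt.1 hkK) (sq_nonneg ‖m‖)
    positivity
  have hm0 : m ≠ 0 := by
    rintro rfl
    exact hme (by simpa using hε.le)
  by_cases hd : f (trial δ x m) - f x < -(δ * ‖m‖ / 4)
  · refine hdet fun u => ?_
    have hR0 : ¬ R ≤ 0 := by omega
    simp only [potential, countedStep, step, Option.isSome_none, hnT, hR, Bool.false_eq_true,
      or_self, if_true, if_false, hk0, hkK, hme, hd, hR0]
    have := passBound_nonneg (L := L) (ε := ε) (not_lt.1 hkK) (sq_nonneg ‖m‖)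
    have h1 : q ^ (R - 1 - 0) * q = q ^ R := by
      rw [← pow_succ]
      congr 1
      omega
    rw [h1]
    push_cast
    have h2 : 0 ≤ q ^ (R - 1 - F) * passBound L ε K k (‖m‖ ^ 2) := by positivity
    linarith
  rcases (not_lt.1 hkK).lt_or_eq with hlt | rfl
  · have hk1 : ¬ K < k + 1 := by omega
    simp only [potential, countedStep, step, Option.isSome_none, hnT, hR, Bool.false_eq_true,
      or_self, if_false, hk0, hkK, hme, hd, hk1, Nat.succ_ne_zero]
    exact lintegral_passBound_average_le hO hOm hL hδ hε hf.lipschitz hm0 hmL hd hlt htT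
      (by positivity)
  · refine hdet fun u => ?_
    simp only [potential, countedStep, step, Option.isSome_none, hnT, hR, Bool.false_eq_true,
      or_self, if_true, if_false, hk0, hkK, hme, hd, Nat.succ_ne_zero, Nat.lt_succ_self]
    gcongr
    exact one_le_passBound_self hε k (pow_le_pow_left₀ hε.le (not_le.1 hme).le 2)

/-- The σ-algebra on configurations that is generated by the entries on which the course of the
algorithm depends. The number of calls and the value of the returned point are left out. -/
instance State.instMeasurableSpace {E : Type*} [MeasurableSpace E] :
    MeasurableSpace (State E) :=
  MeasurableSpace.comap (fun s => (s.t, s.k, s.x, s.m, s.out.isSome)) inferInstance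

theorem State.measurable_iff {E : Type*} [MeasurableSpace E] {α : Type*}
    [MeasurableSpace α] {s : α → State E} :
    Measurable s ↔ Measurable fun a => ((s a).t, (s a).k, (s a).x, (s a).m, (s a).out.isSome) :=
  measurable_comap_iff

theorem measurable_countedStep {f : E → ℝ} {O : E → E → ℝ × E} (hfm : Measurable f)
    (hOm : Measurable (Function.uncurry O)) (L δ ε : ℝ) (K T R : ℕ) :
    Measurable (Function.uncurry (countedStep f O L δ ε K T R)) := by
  have hproj := State.measurable_iff.1 (measurable_fst.comp
    (measurable_snd : Measurable (Prod.snd : ℝ × (State E × ℕ) → State E × ℕ)))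
  simp only [Function.comp_def] at hproj
  have ht := hproj.fst
  have hk := hproj.snd.fst
  have hx := hproj.snd.snd.fst
  have hm := hproj.snd.snd.snd.fst
  have ho := hproj.snd.snd.snd.snd
  dsimp only at ht hk hx hm ho
  have hu : Measurable fun z : ℝ × (State E × ℕ) => z.1 := measurable_fst
  have hF : Measurable fun z : ℝ × (State E × ℕ) => z.2.2 := measurable_snd.comp measurable_snd
  have htr : Measurable fun z : ℝ × (State E × ℕ) => trial δ z.2.1.x z.2.1.m :=
    hx.sub ((measurable_const.div hm.norm).smul hm)
  have hw : Measurable fun z : ℝ × (State E × ℕ) => weight L z.2.1.m := by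
    unfold weight
    fun_prop
  have ho' : MeasurableSet {z : ℝ × (State E × ℕ) | z.2.1.out.isSome = true} :=
    ho (measurableSet_singleton true)
  have hT' : MeasurableSet {z : ℝ × (State E × ℕ) | T < z.2.1.t} :=
    measurableSet_lt measurable_const ht
  have hk0' : MeasurableSet {z : ℝ × (State E × ℕ) | z.2.1.k = 0} :=
    hk (measurableSet_singleton 0)
  have hkK' : MeasurableSet {z : ℝ × (State E × ℕ) | K < z.2.1.k} :=
    measurableSet_lt measurable_const hk
  have hme' : MeasurableSet {z : ℝ × (State E × ℕ) | ‖z.2.1.m‖ ≤ ε} :=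
    measurableSet_le hm.norm measurable_const
  have hd' : MeasurableSet {z : ℝ × (State E × ℕ) |
      f (trial δ z.2.1.x z.2.1.m) - f z.2.1.x < -(δ * ‖z.2.1.m‖ / 4)} :=
    measurableSet_lt ((hfm.comp htr).sub (hfm.comp hx)) (by fun_prop)
  have hR' : MeasurableSet {z : ℝ × (State E × ℕ) | R ≤ z.2.2} :=
    measurableSet_le measurable_const hF
  refine Measurable.prodMk ?_ ?_
  · refine Measurable.ite (ho'.union hT') (measurable_fst.comp measurable_snd) ?_
    refine Measurable.ite hk0' ?_ (Measurable.ite hkK' ?_ (Measurable.ite hme' ?_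
      (Measurable.ite hd' ?_ ?_))) <;> refine State.measurable_iff.2 ?_ <;> dsimp only
    · exact ht.prodMk (measurable_const.prodMk (hx.prodMk
        ((hOm.comp (hx.prodMk measurable_const)).snd.prodMk ho)))
    · exact ht.prodMk (measurable_const.prodMk (hx.prodMk (hm.prodMk ho)))
    · exact ht.prodMk (hk.prodMk (hx.prodMk (hm.prodMk measurable_const)))
    · exact (ht.add_const 1).prodMk (measurable_const.prodMk (htr.prodMk (hm.prodMk ho)))
    · refine ht.prodMk ((hk.add_const 1).prodMk (hx.prodMk (Measurable.prodMk ?_ ho)))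
      exact (hw.smul hm).add ((measurable_const.sub hw).smul
        (hOm.comp ((hx.add (hu.smul (htr.sub hx))).prodMk hm.neg)).snd)
  · exact Measurable.ite (hR'.union (ho'.union (hT'.union hk0'))) hF (Measurable.ite hkK'
      (hF.add_const 1) (Measurable.ite hme' hF (Measurable.ite hd' measurable_const hF)))

omit [InnerProductSpace ℝ E] [SecondCountableTopology E] in
theorem measurable_potential (L ε q : ℝ) (K T R : ℕ) :
    Measurable (potential (E := E) L ε q K T R) := by
  have hproj := State.measurable_iff.1 (measurable_fst : Measurable (Prod.fst : State E × ℕ → _))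
  have ht := hproj.fst
  have hk := hproj.snd.fst
  have hm := hproj.snd.snd.snd.fst
  have ho := hproj.snd.snd.snd.snd
  dsimp only at ht hk hm ho
  have hF : Measurable fun p : State E × ℕ => p.2 := measurable_snd
  have htR : Measurable fun p : State E × ℕ => (p.1.t : ℝ) := measurable_from_nat.comp ht
  have hkR : Measurable fun p : State E × ℕ => (p.1.k : ℝ) := measurable_from_nat.comp hk
  have hpow : Measurable fun p : State E × ℕ => q ^ (R - 1 - p.2) :=
    (measurable_from_nat (f := fun i => q ^ (R - 1 - i))).comp hF
  refine Measurable.ite (measurableSet_le measurable_const hF) measurable_const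
    (Measurable.ite (ho (measurableSet_singleton true)) measurable_const ?_)
  refine ((measurable_const.sub htR).mul_const _).add (hpow.mul ?_)
  refine Measurable.ite (hk (measurableSet_singleton 0)) measurable_const
    (Measurable.ite (measurableSet_lt measurable_const hk) measurable_const ?_)
  unfold passBound
  fun_prop

end CountedRun

/-! ### The failure probability -/

section Probability

variable {E : Type*} [NormedAddCommGroup E] [InnerProductSpace ℝ E]

/-- If `L ≤ ε`, the first gradient already passes the test, and the first oracle call suffices. -/
theorem findsWithin_of_lipschitz_le {f : E → ℝ} {O : E → E → ℝ × E} (hO : IsOracle f O)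
    {L δ ε : ℝ} (hL : 0 ≤ L) (hδ : 0 ≤ δ) (hf : ∀ x y, |f x - f y| ≤ L * ‖x - y‖) (hLε : L ≤ ε)
    {K T : ℕ} (hK : 1 ≤ K) (hT : 1 ≤ T) (x₁ : E) (u : ℕ → ℝ) {B : ℝ} (hB : 1 ≤ B) :
    FindsWithin f O L δ ε K T x₁ u B := by
  have hg : ‖(O x₁ 0).2‖ ≤ ε :=
    (norm_le_of_mem_clarkeGradient hL hf (hO.grad_mem _ _)).trans hLε
  have hrun : run f O L δ ε K T x₁ u 2 =
      { t := 1, k := 1, x := x₁, m := (O x₁ 0).2, calls := 1, out := some x₁ } := by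
    simp [run, step, not_lt.2 hK, not_lt.2 hT, hg]
  refine ⟨2, x₁, by rw [hrun], isGoldsteinStationary_of_norm_le
    (clarkeGradient_subset_goldstein (by simpa using hδ) (hO.grad_mem x₁ 0)) hg, ?_⟩
  rw [hrun]
  simpa using hB

variable [MeasurableSpace E] [BorelSpace E] [SecondCountableTopology E]

/-- With `R` passes granted to each of the `T` while loops, the algorithm fails with probability at
most `T q ^ R`. An unsuccessful pass costs `K + 1` calls, the last pass of a while loop `K`. -/
theorem measure_not_findsWithin_le {f : E → ℝ} {O : E → E → ℝ × E} (hO : IsOracle f O)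
    (hOm : Measurable (Function.uncurry O)) {Δ L δ ε q : ℝ}
    (hL : 0 < L) (hδ : 0 < δ) (hε : 0 < ε) {x₁ : E} (hf : FunctionClass Δ L x₁ f) {K T R : ℕ}
    (hK : 48 * L ^ 2 / ε ^ 2 ≤ K) (hK1 : 1 ≤ K) (hT : 4 * Δ / (ε * δ) ≤ T) (hT1 : 1 ≤ T)
    (hq : 1 / 18 ≤ q) (hR : 1 ≤ R)
    {Ω : Type*} [MeasurableSpace Ω] (μ : Measure Ω) [IsProbabilityMeasure μ]
    (U : ℕ → Ω → ℝ) (hUm : ∀ j, Measurable (U j)) (hUind : iIndepFun U μ)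
    (hUunif : ∀ j, pdf.IsUniform (U j) (Set.Icc (0 : ℝ) 1) μ volume)
    {B : ℝ} (hB : ((T * ((R - 1) * (K + 1) + K) : ℕ) : ℝ) ≤ B) :
    μ {ω | ¬ FindsWithin f O L δ ε K T x₁ (fun j => U j ω) B} ≤ ENNReal.ofReal (T * q ^ R) := by
  have hfc := continuous_of_abs_sub_le hL.le hf.lipschitz
  have hstart : potential L ε q K T R (start x₁) = T * q ^ R := by
    have h1 : q ^ (R - 1) * q = q ^ R := by rw [← pow_succ, Nat.sub_add_cancel hR]
    have h2 : R ≠ 0 := by omega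
    simp only [potential, start, Nat.le_zero, h2, if_false, Option.isSome_none, Bool.false_eq_true,
      if_true, Nat.cast_one, Nat.sub_zero, h1]
    ring
  have hmean := lintegral_orbit_le hUm hUind hUunif (measurable_countedStep hfc.measurable hOm
    L δ ε K T R) (start x₁) (measurable_potential L ε q K T R).ennreal_ofReal
    (fun u j hu => lintegral_potential_countedStep_le hO hOm hL hδ hε hf hK hK1 hq
      (invariant_orbit hO hL hδ hε hf hT hT1 hu j)) (T * R * (K + 2))
  rw [hstart] at hmean
  refine le_trans ?_ hmean
  refine le_trans ?_ (meas_ge_le_lintegral_div (μ := μ) (ε := 1) ?_ one_ne_zero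
    ENNReal.one_ne_top |>.trans_eq (div_one _))
  · refine measure_mono_ae ?_
    filter_upwards [ae_mem_Icc_of_isUniform hUm hUunif] with ω hω hfail
    have hinv := invariant_orbit hO hL hδ hε hf (K := K) (R := R) hT hT1 hω (T * R * (K + 2))
    have hfst := orbit_countedStep_fst f O L δ ε K T R x₁ (fun i => U i ω) (T * R * (K + 2))
    set p := orbit (countedStep f O L δ ε K T R) (start x₁) (fun i => U i ω) (T * R * (K + 2))
      with hp
    -- Otherwise the run has returned by now, within the budget of calls.
    have hF : R ≤ p.2 := by
      by_contra hF
      obtain ⟨y, hy⟩ := Option.ne_none_iff_exists'.1 (hinv.out_ne_none (not_le.1 hF) le_rfl)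
      obtain ⟨hstat, hcalls⟩ := hinv.returned y hy
      refine hfail ⟨_, y, hfst ▸ hy, hstat, ?_⟩
      rw [← hfst]
      exact le_trans (by exact_mod_cast hcalls (not_le.1 hF)) hB
    change 1 ≤ ENNReal.ofReal (potential L ε q K T R p)
    simp [potential, hF]
  · refine Measurable.aemeasurable ?_
    exact (measurable_potential L ε q K T R).ennreal_ofReal.comp ((measurable_orbit
      (measurable_countedStep hfc.measurable hOm L δ ε K T R) _ _).comp
        (measurable_pi_lambda _ hUm))

/-- Choice of the number of passes: `⌈2ℓ/5⌉` passes of failure probability `exp (-5/2)` each fail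
together with probability at most `exp (-ℓ)`, and cost at most `K ℓ` calls as soon as `K ≥ 48`. -/
theorem exists_passes {K : ℕ} (hK : 48 ≤ K) {l : ℝ} (hl : 1 ≤ l) :
    ∃ R : ℕ, 1 ≤ R ∧ Real.exp (-(5 / 2)) ^ R ≤ Real.exp (-l) ∧
      (((R - 1) * (K + 1) + K : ℕ) : ℝ) ≤ K * l := by
  refine ⟨⌈l / (5 / 2)⌉₊, Nat.ceil_pos.2 (by positivity), ?_, ?_⟩
  · rw [← Real.exp_nat_mul, Real.exp_le_exp]
    have := Nat.le_ceil (l / (5 / 2))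
    rw [div_le_iff₀ (by norm_num)] at this
    linarith
  · have h1 := Nat.ceil_lt_add_one (a := l / (5 / 2)) (by positivity)
    have h2 : 1 ≤ ⌈l / (5 / 2)⌉₊ := Nat.ceil_pos.2 (by positivity)
    have hK' : (48 : ℝ) ≤ K := by exact_mod_cast hK
    push_cast [Nat.cast_sub h2]
    by_cases h3 : l ≤ 5 / 2
    · have h4 : ⌈l / (5 / 2)⌉₊ ≤ 1 := Nat.ceil_le.2 (by
        rw [div_le_iff₀ (by norm_num)]; push_cast; linarith)
      rw [le_antisymm h4 h2]
      push_cast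
      nlinarith
    · have h5 : (⌈l / (5 / 2)⌉₊ : ℝ) - 1 ≤ l / (5 / 2) := by linarith
      have h6 := mul_le_mul_of_nonneg_right h5 (by positivity : (0 : ℝ) ≤ K + 1)
      nlinarith [not_le.1 h3]

theorem one_div_eighteen_le_exp : (1 : ℝ) / 18 ≤ Real.exp (-(5 / 2)) := by
  rw [Real.exp_neg, one_div]
  refine inv_anti₀ (Real.exp_pos _) ?_
  have h : Real.exp (5 / 2) ^ 2 = Real.exp 1 ^ 5 := by
    rw [← Real.exp_nat_mul, ← Real.exp_nat_mul]; norm_num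
  have h1 : Real.exp 1 ^ 5 ≤ 2.72 ^ 5 :=
    pow_le_pow_left₀ (Real.exp_pos _).le (by linarith [Real.exp_one_lt_d9]) 5
  refine (sq_le_sq₀ (Real.exp_pos _).le (by norm_num)).1 ?_
  rw [h]
  refine h1.trans (by norm_num)

theorem measure_not_findsWithin_le_ofReal {f : E → ℝ} {O : E → E → ℝ × E} (hO : IsOracle f O)
    (hOm : Measurable (Function.uncurry O)) {Δ L δ ε γ : ℝ}
    (hL : 0 < L) (hδ : 0 < δ) (hε : 0 < ε) (hγ : 0 < γ) {x₁ : E} (hf : FunctionClass Δ L x₁ f)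
    {K T : ℕ} (hK : 48 * L ^ 2 / ε ^ 2 ≤ K) (hK1 : 1 ≤ K) (hT : 4 * Δ / (ε * δ) ≤ T) (hT1 : 1 ≤ T)
    {Ω : Type*} [MeasurableSpace Ω] (μ : Measure Ω) [IsProbabilityMeasure μ]
    (U : ℕ → Ω → ℝ) (hUm : ∀ j, Measurable (U j)) (hUind : iIndepFun U μ)
    (hUunif : ∀ j, pdf.IsUniform (U j) (Set.Icc (0 : ℝ) 1) μ volume) :
    μ {ω | ¬ FindsWithin f O L δ ε K T x₁ (fun j => U j ω)
      ((T : ℝ) * (K : ℝ) * max 1 (Real.log ((T : ℝ) / γ)))} ≤ ENNReal.ofReal γ := by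
  have hl : 1 ≤ max 1 (Real.log ((T : ℝ) / γ)) := le_max_left _ _
  have hT1' : (1 : ℝ) ≤ T := by exact_mod_cast hT1
  have hK1' : (1 : ℝ) ≤ K := by exact_mod_cast hK1
  rcases le_or_gt L ε with hLε | hLε
  · have h1 : ∀ ω, FindsWithin f O L δ ε K T x₁ (fun j => U j ω)
        ((T : ℝ) * (K : ℝ) * max 1 (Real.log ((T : ℝ) / γ))) := fun ω =>
      findsWithin_of_lipschitz_le hO hL.le hδ.le hf.lipschitz hLε hK1 hT1 x₁ _
        (one_le_mul_of_one_le_of_one_le (one_le_mul_of_one_le_of_one_le hT1' hK1') hl)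
    simp [h1]
  · have hK48 : 48 ≤ K := by
      have : (48 : ℝ) ≤ K := by
        refine le_trans ?_ hK
        rw [le_div_iff₀ (by positivity)]
        have := pow_le_pow_left₀ hε.le hLε.le 2
        linarith
      exact_mod_cast this
    obtain ⟨R, hR, hfail, hcost⟩ := exists_passes hK48 hl
    refine (measure_not_findsWithin_le hO hOm hL hδ hε hf hK hK1 hT hT1 one_div_eighteen_le_exp hR
      μ U hUm hUind hUunif ?_).trans (ENNReal.ofReal_le_ofReal ?_)
    · rw [Nat.cast_mul, mul_assoc]
      exact mul_le_mul_of_nonneg_left hcost (by positivity)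
    · have h1 : Real.exp (-max 1 (Real.log ((T : ℝ) / γ))) ≤ γ / T := by
        have h0 : 0 < (T : ℝ) / γ := by positivity
        rw [Real.exp_neg, ← inv_div (T : ℝ) γ]
        refine inv_anti₀ h0 ?_
        rw [← Real.log_le_iff_le_exp h0]
        exact le_max_right _ _
      have h2 := mul_le_mul_of_nonneg_left (hfail.trans h1) (by positivity : (0 : ℝ) ≤ T)
      rwa [show (T : ℝ) * (γ / T) = γ by field_simp] at h2

end Probability

end INGD

end

theorem theorem4 (n : ℕ) (Δ L δ ε γ : ℝ)
    (hΔ : 0 < Δ) (hL : 0 < L) (hδ : 0 < δ) (hε : 0 < ε) (hγ : 0 < γ) (hγ1 : γ < 1)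
    (x₁ : EuclideanSpace ℝ (Fin n))
    (f : EuclideanSpace ℝ (Fin n) → ℝ) (hf : INGD.FunctionClass Δ L x₁ f)
    (O : EuclideanSpace ℝ (Fin n) → EuclideanSpace ℝ (Fin n) → ℝ × EuclideanSpace ℝ (Fin n))
    (hO : INGD.IsOracle f O) (hOm : Measurable (Function.uncurry O))
    {Ω : Type*} [MeasurableSpace Ω] (μ : Measure Ω) [IsProbabilityMeasure μ]
    (U : ℕ → Ω → ℝ) (hUm : ∀ j, Measurable (U j)) (hUind : iIndepFun U μ)
    (hUunif : ∀ j, pdf.IsUniform (U j) (Set.Icc (0 : ℝ) 1) μ volume)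
    (K T : ℕ) (hK : K = ⌈48 * L ^ 2 / ε ^ 2⌉₊) (hT : T = ⌈4 * Δ / (ε * δ)⌉₊) :
    μ {ω | ¬ INGD.FindsWithin f O L δ ε K T x₁ (fun j => U j ω)
        ((T : ℝ) * (K : ℝ) * max 1 (Real.log ((T : ℝ) / γ)))} ≤ ENNReal.ofReal γ ∧
    ((K : ℝ) = 48 * L ^ 2 / ε ^ 2 → (T : ℝ) = 4 * Δ / (ε * δ) →
      1 ≤ Real.log (4 * Δ / (γ * δ * ε)) →
      μ {ω | ¬ INGD.FindsWithin f O L δ ε K T x₁ (fun j => U j ω)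
        (192 * Δ * L ^ 2 / (ε ^ 3 * δ) * Real.log (4 * Δ / (γ * δ * ε)))} ≤
        ENNReal.ofReal γ) := by
  have hK' : 48 * L ^ 2 / ε ^ 2 ≤ K := hK ▸ Nat.le_ceil _
  have hT' : 4 * Δ / (ε * δ) ≤ T := hT ▸ Nat.le_ceil _
  have hK1 : 1 ≤ K := hK ▸ Nat.ceil_pos.2 (by positivity)
  have hT1 : 1 ≤ T := hT ▸ Nat.ceil_pos.2 (by positivity)
  have hmain := INGD.measure_not_findsWithin_le_ofReal hO hOm hL hδ hε hγ hf hK' hK1 hT' hT1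
    μ U hUm hUind hUunif
  refine ⟨hmain, fun hKeq hTeq hlog => ?_⟩
  have e1 : (T : ℝ) / γ = 4 * Δ / (γ * δ * ε) := by rw [hTeq]; field_simp
  have e2 : (T : ℝ) * K = 192 * Δ * L ^ 2 / (ε ^ 3 * δ) := by rw [hTeq, hKeq]; field_simp; norm_num
  rwa [e1, e2, max_eq_right hlog] at hmain
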